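/- Let $s,N\ge 0$ be integers and let $X=\{a_1,\dots,a_N\}$ be a finite multiset of vectors of $\mathbf Z^s$ that spans $\mathbf R^s$ and has no nontrivial nonnegative relation: if $u_1,\dots,u_N\ge 0$ are real and $\sum_i u_ia_i=0$, then all $u_i=0$ (in particular all $a_i\neq 0$). For $x\in\mathbf Z^s$ let $$t_X(x)=\#\Big\{\beta\in\mathbf N^N:\ \sum_{i=1}^N\beta_ia_i=x\Big\},$$ where $\mathbf N=\{0,1,2,\dots\}$. For a finite family $A$ in $\mathbf Z^s$ and $c\in\mathbf Z^s$ put $\Lambda_A^+(c)=\{c+\sum_{a\in A}\alpha_a a:\alpha_a\in\mathbf N\}$, $\Lambda_A^+=\Lambda_A^+(0)$ and $C(A)=\{\sum_{a\in A}\alpha_a a:\alpha_a\in\mathbf R,\ \alpha_a\ge0\}$. Then $t_X(x)$ is finite for every $x\in\mathbf Z^s$, and there are finitely many triples $(A_j,c_j,p_j)$, $j=1,\dots,m$, where $A_j$ is a basis of $\mathbf R^s$ consisting of nonnegative integral multiples of vectors of $X$, $c_j\in\Lambda_X^+$ (so that $\Lambda_{A_j}^+(c_j)\subseteq\Lambda_X^+$),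 and $p_j$ is a nonzero real polynomial in $s$ variables of total degree exactly $N-s$, such that $$t_X(x)=\sum_{j:\ x\in\Lambda_{A_j}^+(c_j)}p_j(x)\qquad\text{for all }x\in\mathbf Z^s .$$ Moreover, $t_X$ is a periodic piecewise polynomial with respect to these shifted cones: there is an integer $d\ge1$ such that for every $S\subseteq\{1,\dots,m\}$ there are real polynomials $P_{S,r}$, $r\in(\mathbf Z/d\mathbf Z)^s$, of degree at most $N-s$, with $t_X(x)=P_{S,\,x\bmod d}(x)$ for every $x\in\mathbf Z^s$ for which $\{j: x\in c_j+C(A_j)\}=S$. -/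

import Mathlib

namespace DiscreteTruncatedPower

/-- An integer vector viewed in `ℝ^s`. -/
def toReal {s : ℕ} (v : Fin s → ℤ) : Fin s → ℝ := fun k => (v k : ℝ)

/-- The nonnegative integral representations of `x` by the multiset `X = {a_1, …, a_N}`, which is
given as a family indexed by `Fin N`. -/
def representations {s N : ℕ} (X : Fin N → Fin s → ℤ) (x : Fin s → ℤ) : Set (Fin N → ℕ) :=
  {β | ∑ i, β i • X i = x}

/-- The discrete truncated power (partition function) `t_X`. -/
noncomputable def partitionFunction {s N : ℕ} (X : Fin N → Fin s → ℤ) (x : Fin s → ℤ) : ℕ :=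
  (representations X x).ncard

/-- The lattice cone `Λ_A^+(c)` with apex `c`; `Λ_A^+` is the case `c = 0`. -/
def latticeCone {s n : ℕ} (A : Fin n → Fin s → ℤ) (c : Fin s → ℤ) : Set (Fin s → ℤ) :=
  {x | ∃ α : Fin n → ℕ, x = c + ∑ i, α i • A i}

/-- The real cone `c + C(A)`. -/
def realCone {s n : ℕ} (A : Fin n → Fin s → ℤ) (c : Fin s → ℤ) : Set (Fin s → ℝ) :=
  {x | ∃ α : Fin n → ℝ, (∀ i, 0 ≤ α i) ∧ x = toReal c + ∑ i, α i • toReal (A i)}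

/-- The nonnegative integral multiples of the vectors of `X`. -/
def multiples {s N : ℕ} (X : Fin N → Fin s → ℤ) : Set (Fin s → ℤ) :=
  {v | ∃ (i : Fin N) (n : ℕ), v = n • X i}

/-- `f : ℤ^s → ℝ` is a periodic piecewise polynomial of degree at most `D` with respect to the
finite family of regions `K`: for a common period `d ≥ 1`, on the integral points of every cell cut
out by the family (the points that lie in `K j` exactly for the indices `j ∈ S`), `f` is given by
polynomials of degree at most `D` which depend only on the residue of the point modulo `d`. -/
def IsPeriodicPiecewisePolynomial {s m : ℕ} (K : Fin m → Set (Fin s → ℝ)) (D : ℕ)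
    (f : (Fin s → ℤ) → ℝ) : Prop :=
  ∃ d : ℕ, 0 < d ∧ ∀ S : Set (Fin m), ∃ P : (Fin s → ZMod d) → MvPolynomial (Fin s) ℝ,
    (∀ r, (P r).totalDegree ≤ D) ∧
    ∀ x : Fin s → ℤ, {j | toReal x ∈ K j} = S →
      f x = MvPolynomial.eval (toReal x) (P (fun k => (x k : ZMod d)))

end DiscreteTruncatedPower

namespace DiscreteTruncatedPower

/-! The generating function of `t_X` is `∏ 1 / (1 - z ^ a_i)`, and the theorem is a partial fraction
decomposition of it. The algebra takes place upstairs, on power series in `N` independent variables;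
the weight map then pushes coefficients down to functions on `ℤ^s`. The kernel of this push-forward
is a module over the polynomials and absorbs all multiples by the toric ideal, so monomials of equal
weight may be identified.

An integral relation among the vectors of a denominator expresses one factor `1 - X_{i₀} ^ n`
through the others modulo the toric ideal (`one_sub_X_pow_mem_toricIdeal_sup`). Multiplying and
dividing by this factor trades one unit of exponent at another index for one at `i₀`. The total
exponent stays `N`, and the vectors left when a factor disappears still span, so in the end every
denominator is supported on a basis (`geomSeries_mem_basicSpan`).

Over a basis with exponents `h` the push-forward lives on one lattice cone, where it is a product of
binomial coefficients of degree `∑ (h - 1) = N - s`; a monomial numerator only moves the apex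
(`pushForward_monomial_smul_geomSeries`). Periodicity follows because a lattice cone is cut out of
its real cone by a congruence condition. -/

theorem monomial_smul_eq_mul {σ : Type*} (γ : σ →₀ ℕ) (r : ℝ) (F : MvPowerSeries σ ℝ) :
    MvPolynomial.monomial γ r • F = MvPowerSeries.monomial γ r * F := by
  rw [Algebra.smul_def, MvPowerSeries.algebraMap_apply', Algebra.algebraMap_self,
    MvPolynomial.coe_monomial, MvPowerSeries.map_id, RingHom.id_apply]

/-! ### Geometric series and their denominators. -/

section GeomSeries

variable {σ : Type*} [Fintype σ]

/-- The power series `∏ i, (1 - X i ^ n i) ^ (-h i)`. -/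
noncomputable def geomSeries (n h : σ → ℕ) : MvPowerSeries σ ℝ := fun β =>
  ∏ i, if n i ∣ β i then ((h i).multichoose (β i / n i) : ℝ) else 0

theorem coeff_geomSeries (n h : σ → ℕ) (β : σ →₀ ℕ) :
    MvPowerSeries.coeff β (geomSeries n h) =
      ∏ i, if n i ∣ β i then ((h i).multichoose (β i / n i) : ℝ) else 0 := rfl

/-- Pascal's rule, as the one-variable case of multiplying by `1 - X ^ n`. -/
theorem multichoose_div_sub (n h k : ℕ) (hn : 0 < n) :
    (if n ∣ k then ((h + 1).multichoose (k / n) : ℝ) else 0) -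
      (if n ≤ k then (if n ∣ k - n then ((h + 1).multichoose ((k - n) / n) : ℝ) else 0) else 0) =
      if n ∣ k then (h.multichoose (k / n) : ℝ) else 0 := by
  by_cases hk : n ∣ k
  · obtain ⟨q, rfl⟩ := hk
    cases q with
    | zero => simp [hn.ne']
    | succ q =>
      have h1 : n * (q + 1) - n = n * q := by rw [mul_add, mul_one, Nat.add_sub_cancel]
      have h2 : n ≤ n * (q + 1) := Nat.le_mul_of_pos_right _ (Nat.succ_pos _)
      simp [h1, h2, hn, Nat.multichoose_succ_succ]
  · have : n ≤ k → ¬ n ∣ k - n := fun hle hd => hk ((Nat.dvd_sub_iff_left hle dvd_rfl).1 hd)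
    by_cases hle : n ≤ k <;> simp [hk, this, hle]

theorem geomSeries_zero (n : σ → ℕ) (hn : ∀ i, 0 < n i) :
    geomSeries n 0 = 1 := by
  classical
  ext β
  rw [coeff_geomSeries, MvPowerSeries.coeff_one]
  split_ifs with hβ
  · simp [hβ]
  · obtain ⟨i, hi⟩ : ∃ i, β i ≠ 0 := by
      by_contra! H
      exact hβ (Finsupp.ext H)
    refine Finset.prod_eq_zero (Finset.mem_univ i) ?_
    split_ifs with hd
    · obtain ⟨q, hq⟩ := hd
      rcases q with _ | q
      · simp [hq] at hi
      · simp [hq, hn i]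
    · rfl

variable [DecidableEq σ]

theorem one_sub_smul_geomSeries (n h : σ → ℕ) (i : σ) (hn : 0 < n i) :
    (1 - MvPolynomial.X i ^ n i : MvPolynomial σ ℝ) • geomSeries n (h + Pi.single i 1) =
      geomSeries n h := by
  ext β
  rw [sub_smul, one_smul, MvPolynomial.X_pow_eq_monomial, monomial_smul_eq_mul, map_sub,
    MvPowerSeries.coeff_monomial_mul, one_mul]
  simp only [coeff_geomSeries, ← Finset.mul_prod_erase Finset.univ _ (Finset.mem_univ i)]
  have hE : ∀ f : σ →₀ ℕ, (∀ j, j ≠ i → f j = β j) →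
      (∏ j ∈ Finset.univ.erase i, if n j ∣ f j then
        (((h + Pi.single i 1 : σ → ℕ) j).multichoose (f j / n j) : ℝ) else 0) =
      ∏ j ∈ Finset.univ.erase i, if n j ∣ β j then ((h j).multichoose (β j / n j) : ℝ) else 0 := by
    intro f hf
    refine Finset.prod_congr rfl fun j hj => ?_
    have hj' := Finset.ne_of_mem_erase hj
    simp [hf j hj', hj']
  rw [hE β fun _ _ => rfl, hE (β - Finsupp.single i (n i)) fun j hj => by
    simp [hj.symm], ← multichoose_div_sub (n i) (h i) (β i) hn]
  simp only [Finsupp.single_le_iff, Pi.add_apply, Pi.single_eq_same, Finsupp.tsub_apply,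
    Finsupp.single_eq_same]
  split_ifs <;> ring

/-- The denominator of `geomSeries n h`. -/
noncomputable def denominator (n h : σ → ℕ) : MvPolynomial σ ℝ :=
  ∏ i, (1 - MvPolynomial.X i ^ n i) ^ h i

theorem denominator_smul_geomSeries (n h : σ → ℕ) (hn : ∀ i, 0 < n i) :
    denominator n h • geomSeries n h = 1 := by
  induction hk : ∑ i, h i generalizing h with
  | zero =>
    have h0 : h = 0 := by
      funext i
      exact (Finset.sum_eq_zero_iff.1 hk) i (Finset.mem_univ i)
    simp [h0, denominator, geomSeries_zero n hn]
  | succ k ih =>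
    obtain ⟨i, hi⟩ : ∃ i, h i ≠ 0 := by
      by_contra! H
      simp [H] at hk
    obtain ⟨h', rfl⟩ : ∃ h', h = h' + Pi.single i 1 :=
      ⟨h - Pi.single i 1, (tsub_add_cancel_of_le (by
        intro j
        by_cases hj : j = i
        · subst hj
          simpa using Nat.one_le_iff_ne_zero.2 hi
        · simp [hj])).symm⟩
    have h1 : denominator n (h' + Pi.single i 1) =
        denominator n h' * (1 - MvPolynomial.X i ^ n i) := by
      simp only [denominator, Pi.add_apply, pow_add, Finset.prod_mul_distrib]
      congr 1
      rw [Finset.prod_eq_single i (fun j _ hj => by simp [hj]) (by simp)]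
      simp
    rw [h1, mul_smul, one_sub_smul_geomSeries n h' i (hn i)]
    refine ih h' ?_
    simpa [Finset.sum_add_distrib] using hk

/-- Since `1 - X ^ n` divides `1 - X ^ n'` when `n ∣ n'`, the moduli may be enlarged at the cost of
a polynomial numerator, without changing `h`. -/
theorem geomSeries_eq_smul_of_dvd (n n' h : σ → ℕ) (hn : ∀ i, 0 < n i) (hn' : ∀ i, 0 < n' i)
    (hd : ∀ i, n i ∣ n' i) : ∃ q : MvPolynomial σ ℝ, geomSeries n h = q • geomSeries n' h := by
  have hD : denominator n h ∣ denominator n' h := by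
    refine Finset.prod_dvd_prod_of_dvd _ _ fun i _ => pow_dvd_pow_of_dvd ?_ _
    obtain ⟨k, hk⟩ := hd i
    rw [hk, pow_mul]
    simpa using sub_dvd_pow_sub_pow (1 : MvPolynomial σ ℝ) (MvPolynomial.X i ^ n i) k
  obtain ⟨q, hq⟩ := hD
  refine ⟨q, ?_⟩
  have h1 := denominator_smul_geomSeries n h hn
  have h2 := denominator_smul_geomSeries n' h hn'
  calc geomSeries n h = (denominator n' h • geomSeries n' h) * geomSeries n h := by
        rw [h2, one_mul]
    _ = (q • geomSeries n' h) * (denominator n h • geomSeries n h) := by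
        rw [hq]; simp only [Algebra.smul_def, map_mul]; ring
    _ = _ := by rw [h1, mul_one]

end GeomSeries

/-! ### Push-forward along the weight and its kernel. -/

section PushForward

variable {σ M : Type*} [AddCommGroup M] (w : (σ →₀ ℕ) →+ M) (hw : ∀ x, (w ⁻¹' {x}).Finite)

/-- The push-forward of a power series along a weight with finite fibres: the coefficient at `x`
is the sum of the coefficients of the monomials of weight `x`. -/
noncomputable def pushForward : MvPowerSeries σ ℝ →ₗ[ℝ] M → ℝ where
  toFun F x := ∑ β ∈ (hw x).toFinset, MvPowerSeries.coeff β F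
  map_add' F G := by
    funext x
    simp [Finset.sum_add_distrib]
  map_smul' r F := by
    funext x
    simp [Finset.mul_sum]

theorem pushForward_apply (F : MvPowerSeries σ ℝ) (x : M) :
    pushForward w hw F x = ∑ β ∈ (hw x).toFinset, MvPowerSeries.coeff β F := rfl

/-- Multiplication by a monomial becomes translation by its weight, which makes the kernel stable
under polynomials. -/
theorem pushForward_monomial_smul (γ : σ →₀ ℕ) (r : ℝ) (F : MvPowerSeries σ ℝ) (x : M) :
    pushForward w hw (MvPolynomial.monomial γ r • F) x = r * pushForward w hw F (x - w γ) := by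
  classical
  simp only [pushForward_apply, monomial_smul_eq_mul, MvPowerSeries.coeff_monomial_mul,
    Finset.mul_sum]
  rw [← Finset.sum_filter]
  refine Finset.sum_nbij' (fun β => β - γ) (fun β => β + γ) ?_ ?_ ?_ ?_ ?_
  · intro β hβ
    simp only [Finset.mem_filter, Set.Finite.mem_toFinset, Set.mem_preimage,
      Set.mem_singleton_iff] at hβ ⊢
    rw [eq_sub_iff_add_eq, ← map_add, tsub_add_cancel_of_le hβ.2, hβ.1]
  · intro β hβ
    simp only [Finset.mem_filter, Set.Finite.mem_toFinset, Set.mem_preimage,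
      Set.mem_singleton_iff] at hβ ⊢
    exact ⟨by rw [map_add, hβ, sub_add_cancel], le_add_self⟩
  · intro β hβ
    exact tsub_add_cancel_of_le (Finset.mem_filter.1 hβ).2
  · intro β _
    exact add_tsub_cancel_right β γ
  · intro β _
    rfl

theorem pushForward_smul_eq_zero (q : MvPolynomial σ ℝ) {F : MvPowerSeries σ ℝ}
    (hF : pushForward w hw F = 0) : pushForward w hw (q • F) = 0 := by
  induction q using MvPolynomial.induction_on' with
  | monomial γ r =>
    funext x
    rw [pushForward_monomial_smul, hF]
    simp
  | add p q hp hq => rw [add_smul, map_add, hp, hq, add_zero]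

/-- The kernel of the push-forward, a module over the polynomial ring. -/
noncomputable def pushForwardKer : Submodule (MvPolynomial σ ℝ) (MvPowerSeries σ ℝ) where
  carrier := {F | pushForward w hw F = 0}
  zero_mem' := map_zero _
  add_mem' {F G} hF hG := by
    simp only [Set.mem_ofPred_eq] at hF hG ⊢
    rw [map_add, hF, hG, add_zero]
  smul_mem' q _ hF := pushForward_smul_eq_zero w hw q hF

theorem mem_pushForwardKer {F : MvPowerSeries σ ℝ} :
    F ∈ pushForwardKer w hw ↔ pushForward w hw F = 0 := Iff.rfl

theorem monomial_sub_smul_mem_pushForwardKer {γ δ : σ →₀ ℕ} (h : w γ = w δ)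
    (F : MvPowerSeries σ ℝ) :
    (MvPolynomial.monomial γ 1 - MvPolynomial.monomial δ 1 : MvPolynomial σ ℝ) • F ∈
      pushForwardKer w hw := by
  rw [mem_pushForwardKer]
  funext x
  rw [sub_smul, map_sub, Pi.sub_apply, pushForward_monomial_smul, pushForward_monomial_smul, h,
    sub_self, Pi.zero_apply]

end PushForward

/-! ### Toric relations and the exchange of denominator factors. -/

section PartialFractions

variable {σ M : Type*} [AddCommGroup M]

/-- The toric ideal of a family of vectors, generated by the binomials of equal weight. -/
noncomputable def toricIdeal (a : σ → M) : Ideal (MvPolynomial σ ℝ) :=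
  Ideal.span {q | ∃ γ δ : σ →₀ ℕ, Finsupp.weight a γ = Finsupp.weight a δ ∧
    q = MvPolynomial.monomial γ 1 - MvPolynomial.monomial δ 1}

theorem toricIdeal_smul_mem_pushForwardKer (a : σ → M)
    (hw : ∀ x, (Finsupp.weight a ⁻¹' {x}).Finite) {q : MvPolynomial σ ℝ} (hq : q ∈ toricIdeal a)
    (F : MvPowerSeries σ ℝ) : q • F ∈ pushForwardKer (Finsupp.weight a) hw := by
  refine Submodule.span_induction (p := fun q _ => q • F ∈ pushForwardKer (Finsupp.weight a) hw)
    ?_ ?_ ?_ ?_ hq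
  · rintro _ ⟨γ, δ, h, rfl⟩
    exact monomial_sub_smul_mem_pushForwardKer _ hw h F
  · simp
  · intro p q _ _ hp hq
    rw [add_smul]
    exact add_mem hp hq
  · intro r q _ hq
    rw [smul_eq_mul, mul_smul]
    exact Submodule.smul_mem _ r hq

variable [Fintype σ]

/-- Modulo the right-hand ideal, `X i ^ n i = 1` for every other `i` in the relation. The binomial
of the relation equates the products over its positive and negative parts, where only the power of
`X i₀` survives. -/
theorem one_sub_X_pow_mem_toricIdeal_sup (a : σ → M) (n : σ → ℕ) (c : σ → ℤ)
    (hc : ∑ i, c i • a i = 0) (hn : ∀ i, (n i : ℤ) ∣ c i) (i₀ : σ) (hi₀ : c i₀ = n i₀) :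
    (1 - MvPolynomial.X i₀ ^ n i₀ : MvPolynomial σ ℝ) ∈ toricIdeal a ⊔
      Ideal.span ((fun i => 1 - MvPolynomial.X i ^ n i) '' {i | i ≠ i₀ ∧ c i ≠ 0}) := by
  set I : Ideal (MvPolynomial σ ℝ) := toricIdeal a ⊔
      Ideal.span ((fun i => 1 - MvPolynomial.X i ^ n i) '' {i | i ≠ i₀ ∧ c i ≠ 0}) with hI
  let φ := Ideal.Quotient.mk I
  have hone : ∀ i, i ≠ i₀ → c i ≠ 0 → φ (MvPolynomial.X i) ^ n i = 1 := by
    intro i h1 h2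
    have : φ (1 - MvPolynomial.X i ^ n i) = 0 :=
      Ideal.Quotient.eq_zero_iff_mem.2 (hI ▸ Ideal.mem_sup_right
        (Ideal.subset_span ⟨i, ⟨h1, h2⟩, rfl⟩))
    rw [map_sub, map_one, map_pow, sub_eq_zero] at this
    exact this.symm
  -- Both signs are needed, since `toNat` of `c i` and of `-c i` are the exponents of the two
  -- monomials.
  have hpow : ∀ i, i ≠ i₀ → ∀ k : ℤ, k = c i ∨ k = - c i → φ (MvPolynomial.X i) ^ k.toNat = 1 := by
    intro i hi k hk
    by_cases h0 : c i = 0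
    · have : k = 0 := by rcases hk with rfl | rfl <;> simp [h0]
      simp [this]
    · rcases le_or_gt k 0 with hk0 | hk0
      · simp [Int.toNat_of_nonpos hk0]
      · have hd : n i ∣ k.toNat := by
          rw [← Int.natCast_dvd_natCast, Int.toNat_of_nonneg hk0.le]
          rcases hk with rfl | rfl
          · exact hn i
          · exact (dvd_neg).2 (hn i)
        obtain ⟨q, hq⟩ := hd
        rw [hq, pow_mul, hone i hi h0, one_pow]
  have hmon : ∀ γ : σ →₀ ℕ, φ (MvPolynomial.monomial γ 1) = ∏ i, φ (MvPolynomial.X i) ^ γ i := by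
    intro γ
    rw [MvPolynomial.monomial_eq, Finsupp.prod_fintype _ _ (by simp), map_one, one_mul, map_prod]
    simp
  let γ : σ →₀ ℕ := Finsupp.equivFunOnFinite.symm fun i => (c i).toNat
  let δ : σ →₀ ℕ := Finsupp.equivFunOnFinite.symm fun i => (- c i).toNat
  have hγδ : Finsupp.weight a γ = Finsupp.weight a δ := by
    rw [Finsupp.weight_apply, Finsupp.weight_apply, Finsupp.sum_fintype _ _ (by simp),
      Finsupp.sum_fintype _ _ (by simp), ← sub_eq_zero, ← Finset.sum_sub_distrib, ← hc]
    refine Finset.sum_congr rfl fun i _ => ?_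
    have : c i = ((c i).toNat : ℤ) - ((- c i).toNat : ℤ) := by omega
    conv_rhs => rw [this, sub_smul, natCast_zsmul, natCast_zsmul]
    rfl
  have hrel : φ (MvPolynomial.monomial γ 1) = φ (MvPolynomial.monomial δ 1) := by
    rw [← sub_eq_zero, ← map_sub]
    exact Ideal.Quotient.eq_zero_iff_mem.2 (hI ▸ Ideal.mem_sup_left
      (Ideal.subset_span ⟨γ, δ, hγδ, rfl⟩))
  have hγ : ∏ i, φ (MvPolynomial.X i) ^ γ i = φ (MvPolynomial.X i₀) ^ γ i₀ :=
    Finset.prod_eq_single i₀ (fun i _ hi => hpow i hi _ (Or.inl rfl)) (by simp)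
  have hδ : ∏ i, φ (MvPolynomial.X i) ^ δ i = φ (MvPolynomial.X i₀) ^ δ i₀ :=
    Finset.prod_eq_single i₀ (fun i _ hi => hpow i hi _ (Or.inr rfl)) (by simp)
  rw [hmon, hmon, hγ, hδ] at hrel
  have h1 : γ i₀ = n i₀ := by
    change (c i₀).toNat = n i₀
    omega
  have h2 : δ i₀ = 0 := by
    change (- c i₀).toNat = 0
    omega
  rw [h1, h2, pow_zero] at hrel
  refine Ideal.Quotient.eq_zero_iff_mem.1 ?_
  change φ _ = 0
  rw [map_sub, map_one, map_pow, hrel, sub_self]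

variable [DecidableEq σ]

/-- Trading factors of the denominator for the factor `i₀` until some factor disappears. -/
theorem geomSeries_mem_of_forall_reduced (a : σ → M)
    (hw : ∀ x, (Finsupp.weight a ⁻¹' {x}).Finite)
    (G : Submodule (MvPolynomial σ ℝ) (MvPowerSeries σ ℝ))
    (hG : pushForwardKer (Finsupp.weight a) hw ≤ G) (n : σ → ℕ) (hn : ∀ i, 0 < n i) (i₀ : σ)
    (C : Set σ) (hC : i₀ ∉ C)
    (hI : (1 - MvPolynomial.X i₀ ^ n i₀ : MvPolynomial σ ℝ) ∈ toricIdeal a ⊔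
      Ideal.span ((fun i => 1 - MvPolynomial.X i ^ n i) '' C))
    (h : σ → ℕ) (h₀ : h i₀ ≠ 0) (hhC : ∀ i ∈ C, h i ≠ 0)
    (hred : ∀ h' : σ → ℕ, ∀ i ∈ C, h' i = 0 → (∀ j, j ≠ i → (h' j ≠ 0 ↔ h j ≠ 0)) →
      ∑ j, h' j = ∑ j, h j → geomSeries n h' ∈ G) :
    geomSeries n h ∈ G := by
  -- Each trade moves one unit of exponent from `C` to `i₀`, so the total exponent away from `i₀`
  -- decreases.
  induction hk : ∑ j ∈ Finset.univ.erase i₀, h j using Nat.strong_induction_on generalizing h with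
  | _ k ih =>
  obtain ⟨p, hp, q, hq, hpq⟩ := Submodule.mem_sup.1 hI
  have hsplit : geomSeries n h = p • geomSeries n (h + Pi.single i₀ 1) +
      q • geomSeries n (h + Pi.single i₀ 1) := by
    rw [← add_smul, hpq, one_sub_smul_geomSeries n h i₀ (hn i₀)]
  rw [hsplit]
  refine G.add_mem (hG (toricIdeal_smul_mem_pushForwardKer a hw hp _)) ?_
  -- It suffices to treat the generators of the ideal, each of which cancels one factor of the
  -- enlarged denominator.
  suffices hle : Ideal.span ((fun i => 1 - MvPolynomial.X i ^ n i) '' C) ≤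
      G.comap (LinearMap.toSpanSingleton (MvPolynomial σ ℝ) (MvPowerSeries σ ℝ)
        (geomSeries n (h + Pi.single i₀ 1))) from hle hq
  rw [Ideal.span_le]
  rintro _ ⟨i, hi, rfl⟩
  have hne : i ≠ i₀ := fun e => hC (e ▸ hi)
  have hi1 := hhC i hi
  obtain ⟨h', hh'⟩ : ∃ h' : σ → ℕ, h + Pi.single i₀ 1 = h' + Pi.single i 1 :=
    ⟨h + Pi.single i₀ 1 - Pi.single i 1, (tsub_add_cancel_of_le (by
      intro j
      by_cases hj : j = i
      · subst hj
        simp [hne]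
        omega
      · simp [hj])).symm⟩
  have hval : ∀ j, j ≠ i → j ≠ i₀ → h' j = h j := by
    intro j h1 h2
    have := congrFun hh' j
    simp [h1, h2] at this
    exact this.symm
  have hval0 : h' i₀ = h i₀ + 1 := by
    have := congrFun hh' i₀
    simp [hne.symm] at this
    exact this.symm
  have hvali : h' i + 1 = h i := by
    have := congrFun hh' i
    simp [hne] at this
    exact this.symm
  have hsum : ∑ j, h' j = ∑ j, h j := by
    have := congrArg (fun f : σ → ℕ => ∑ j, f j) hh'
    simp [Finset.sum_add_distrib] at this
    exact this.symm
  have hsupp : ∀ j, j ≠ i → (h' j ≠ 0 ↔ h j ≠ 0) := by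
    intro j hj
    by_cases hj0 : j = i₀
    · subst hj0
      omega
    · rw [hval j hj hj0]
  rw [SetLike.mem_coe, Submodule.mem_comap, LinearMap.toSpanSingleton_apply, hh',
    one_sub_smul_geomSeries n h' i (hn i)]
  by_cases hz : h' i = 0
  · exact hred h' i hi hz hsupp hsum
  · have hsupp' : ∀ j, h' j ≠ 0 ↔ h j ≠ 0 := by
      intro j
      by_cases hj : j = i
      · subst hj
        omega
      · exact hsupp j hj
    refine ih _ ?_ h' ((hsupp' i₀).2 h₀) (fun j hj => (hsupp' j).2 (hhC j hj)) ?_ rfl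
    · rw [← hk]
      refine Finset.sum_lt_sum (fun j hj => ?_) ⟨i, by simp [hne], by omega⟩
      by_cases hji : j = i
      · subst hji
        omega
      · exact (hval j hji (Finset.ne_of_mem_erase hj)).le
    · intro h'' j hj h1 h2 h3
      exact hred h'' j hj h1 (fun l hl => (h2 l hl).trans (hsupp' l)) (h3.trans hsum)

end PartialFractions

/-! ### Reduction to denominators supported on bases. -/

section Basis

variable {s N : ℕ}

/-- The support of `h` picks out a basis of `ℝ^s` from the family `X`. -/
def SupportIsBasis (X : Fin N → Fin s → ℤ) (h : Fin N → ℕ) : Prop :=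
  LinearIndepOn ℤ X {i | h i ≠ 0} ∧
    Submodule.span ℝ ((fun i => toReal (X i)) '' {i | h i ≠ 0}) = ⊤

/-- The power series spanned by geometric series supported on bases, modulo the kernel of the
push-forward. -/
noncomputable def basicSpan (X : Fin N → Fin s → ℤ)
    (hw : ∀ x, ((Finsupp.weight X : (Fin N →₀ ℕ) →+ Fin s → ℤ) ⁻¹' {x}).Finite) (D : ℕ) :
    Submodule (MvPolynomial (Fin N) ℝ) (MvPowerSeries (Fin N) ℝ) :=
  Submodule.span (MvPolynomial (Fin N) ℝ) {F | ∃ n h : Fin N → ℕ, (∀ i, 0 < n i) ∧ ∑ i, h i = D ∧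
    SupportIsBasis X h ∧ F = geomSeries n h} ⊔ pushForwardKer (Finsupp.weight X) hw

theorem sum_smul_toReal {ι : Type*} (t : Finset ι) (c : ι → ℤ) (v : ι → Fin s → ℤ) :
    toReal (∑ i ∈ t, c i • v i) = ∑ i ∈ t, (c i : ℝ) • toReal (v i) := by
  funext k
  simp [toReal, Finset.sum_apply]

theorem span_image_diff_singleton_of_relation (X : Fin N → Fin s → ℤ) (c : Fin N → ℤ)
    (hc : ∑ i, c i • X i = 0) (B : Set (Fin N)) (hcB : ∀ i, c i ≠ 0 → i ∈ B) (i : Fin N)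
    (hi : c i ≠ 0)
    (hB : Submodule.span ℝ ((fun i => toReal (X i)) '' B) = ⊤) :
    Submodule.span ℝ ((fun i => toReal (X i)) '' (B \ {i})) = ⊤ := by
  rw [eq_top_iff, ← hB, Submodule.span_le]
  rintro _ ⟨j, hj, rfl⟩
  by_cases hji : j = i
  · subst hji
    have h0 : ∑ i, (c i : ℝ) • toReal (X i) = 0 := by
      rw [← sum_smul_toReal, hc]
      funext k
      simp [toReal]
    rw [← Finset.add_sum_erase _ _ (Finset.mem_univ j)] at h0
    have hj0 : (c j : ℝ) ≠ 0 := by exact_mod_cast hi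
    have hx : toReal (X j) =
        (c j : ℝ)⁻¹ • -∑ i ∈ Finset.univ.erase j, (c i : ℝ) • toReal (X i) := by
      rw [← eq_neg_of_add_eq_zero_left h0, smul_smul, inv_mul_cancel₀ hj0, one_smul]
    change toReal (X j) ∈ _
    rw [hx]
    refine Submodule.smul_mem _ _ (neg_mem (Submodule.sum_mem _ fun l hl => ?_))
    by_cases hl0 : c l = 0
    · simp [hl0]
    · exact Submodule.smul_mem _ _ (Submodule.subset_span
        ⟨l, ⟨hcB l hl0, Finset.ne_of_mem_erase hl⟩, rfl⟩)
  · exact Submodule.subset_span ⟨j, ⟨hj, hji⟩, rfl⟩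

/-- Induction on the size of the support: a dependent support carries a relation, and trading along
it removes a vector of the relation, which lies in the span of the rest. -/
theorem geomSeries_mem_basicSpan (X : Fin N → Fin s → ℤ)
    (hw : ∀ x, ((Finsupp.weight X : (Fin N →₀ ℕ) →+ Fin s → ℤ) ⁻¹' {x}).Finite) (D : ℕ) (n h : Fin N → ℕ)
    (hn : ∀ i, 0 < n i) (hD : ∑ i, h i = D)
    (hspan : Submodule.span ℝ ((fun i => toReal (X i)) '' {i | h i ≠ 0}) = ⊤) :
    geomSeries n h ∈ basicSpan X hw D := by
  induction hk : (Finset.univ.filter fun i => h i ≠ 0).card using Nat.strong_induction_on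
    generalizing n h with
  | _ k ih =>
  by_cases hind : LinearIndepOn ℤ X {i | h i ≠ 0}
  · exact Submodule.mem_sup_left (Submodule.subset_span ⟨n, h, hn, hD, ⟨hind, hspan⟩, rfl⟩)
  obtain ⟨c, hc, hcB, i₀, hi₀⟩ : ∃ c : Fin N → ℤ, ∑ i, c i • X i = 0 ∧
      (∀ i, c i ≠ 0 → h i ≠ 0) ∧ ∃ i, 0 < c i := by
    have hB : ({i | h i ≠ 0} : Set (Fin N)) = ↑(Finset.univ.filter fun i => h i ≠ 0) := by
      ext i
      simp
    rw [hB, linearIndepOn_finset_iff] at hind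
    push Not at hind
    obtain ⟨f, hf, i, hi, hfi⟩ := hind
    let c : Fin N → ℤ := fun i => if h i ≠ 0 then f i else 0
    have hc : ∑ i, c i • X i = 0 := by
      rw [← hf, Finset.sum_filter]
      refine Finset.sum_congr rfl fun j _ => ?_
      by_cases hj : h j = 0 <;> simp [c, hj]
    have hcB : ∀ i, c i ≠ 0 → h i ≠ 0 := by
      intro j hj hj0
      simp [c, hj0] at hj
    have hci : c i ≠ 0 := by
      have := (Finset.mem_filter.1 hi).2
      simp [c, this, hfi]
    rcases lt_or_gt_of_ne hci with hlt | hgt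
    · refine ⟨-c, ?_, fun j hj => hcB j (by simpa using hj), i, by simpa using hlt⟩
      simp only [Pi.neg_apply, neg_smul, Finset.sum_neg_distrib, hc, neg_zero]
    · exact ⟨c, hc, hcB, i, hgt⟩
  -- Scaling the relation by `K` makes each coefficient divisible by its modulus; raising the
  -- modulus at `i₀` to `K * c i₀` makes it equal to the coefficient there.
  let K : ℕ := ∏ i, n i
  have hK : 0 < K := Finset.prod_pos fun i _ => hn i
  have hnK : ∀ i, n i ∣ K := fun i => Finset.dvd_prod_of_mem n (Finset.mem_univ i)
  have hc₀ : ((c i₀).toNat : ℤ) = c i₀ := Int.toNat_of_nonneg hi₀.le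
  let n' : Fin N → ℕ := Function.update n i₀ (K * (c i₀).toNat)
  have hn' : ∀ i, 0 < n' i := by
    intro i
    by_cases hi : i = i₀
    · subst hi
      simp only [n', Function.update_self]
      exact Nat.mul_pos hK (by omega)
    · simp [n', hi, hn i]
  have hdvd : ∀ i, n i ∣ n' i := by
    intro i
    by_cases hi : i = i₀
    · subst hi
      simp only [n', Function.update_self]
      exact Dvd.dvd.mul_right (hnK i) _
    · simp [n', hi]
  obtain ⟨q, hq⟩ := geomSeries_eq_smul_of_dvd n n' h hn hn' hdvd
  rw [hq]
  refine Submodule.smul_mem _ q ?_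
  have hI := one_sub_X_pow_mem_toricIdeal_sup X n' (fun i => (K : ℤ) * c i)
    (by simp only [mul_smul, ← Finset.smul_sum, hc, smul_zero]) (by
      intro i
      by_cases hi : i = i₀
      · subst hi
        simp [n', hc₀]
      · simp only [n', Function.update_of_ne hi]
        exact Dvd.dvd.mul_right (Int.natCast_dvd_natCast.2 (hnK i)) _) i₀ (by simp [n', hc₀])
  refine geomSeries_mem_of_forall_reduced X hw _ le_sup_right n' hn' i₀ _ (by simp) hI h
    (hcB i₀ hi₀.ne') (fun i hi => hcB i fun h0 => hi.2 (by simp [h0])) ?_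
  intro h' i hi h1 h2 h3
  have hci : c i ≠ 0 := fun h0 => hi.2 (by simp [h0])
  have hset : ({j | h' j ≠ 0} : Set (Fin N)) = {j | h j ≠ 0} \ {i} := by
    ext j
    by_cases hj : j = i
    · subst hj
      simp [h1]
    · simpa [hj] using h2 j hj
  refine ih _ ?_ n' h' hn' (h3.trans hD) ?_ rfl
  · rw [← hk]
    refine Finset.card_lt_card (Finset.ssubset_iff_of_subset ?_ |>.2 ⟨i, ?_, ?_⟩)
    · intro j hj
      have hj' : j ∈ ({j | h' j ≠ 0} : Set (Fin N)) := (Finset.mem_filter.1 hj).2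
      rw [hset] at hj'
      exact Finset.mem_filter.2 ⟨Finset.mem_univ _, hj'.1⟩
    · simpa using hcB i hci
    · simp [h1]
  · rw [hset]
    exact span_image_diff_singleton_of_relation X c hc _ hcB i hci hspan

end Basis

/-! ### Binomial coefficients as polynomials of exact degree. -/

section Polynomial

theorem multichoose_succ_eq_prod (d k : ℕ) :
    ((d + 1).multichoose k : ℝ) = ∏ t ∈ Finset.range d, ((t : ℝ) + 1)⁻¹ * (k + (t + 1)) := by
  induction d with
  | zero => simp
  | succ d ih =>
    rw [Finset.prod_range_succ, ← ih, Nat.multichoose_eq, Nat.multichoose_eq]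
    have h1 : d + 1 + 1 + k - 1 = d + k + 1 := by omega
    have h2 : d + 1 + k - 1 = d + k := by omega
    have h3 : (d + k + 1).choose k = (d + k + 1).choose (d + 1) :=
      Nat.choose_symm_of_eq_add (by omega)
    have h4 : (d + k).choose k = (d + k).choose d := Nat.choose_symm_of_eq_add (by omega)
    rw [h1, h2, h3, h4]
    have h5 : ((d + k + 1 : ℕ) : ℝ) * ((d + k).choose d : ℝ) =
        ((d + k + 1).choose (d + 1) : ℝ) * ((d + 1 : ℕ) : ℝ) := by
      exact_mod_cast Nat.add_one_mul_choose_eq (d + k) d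
    have h6 : ((d : ℝ) + 1) ≠ 0 := by positivity
    push_cast at h5
    field_simp
    linarith

variable {s : ℕ}

/-- The affine coordinates with respect to a frame are polynomials of degree one. -/
theorem exists_coordinate_polynomial (v : Fin s → Fin s → ℝ) (hv : LinearIndependent ℝ v)
    (c : Fin s → ℝ) (k : Fin s) : ∃ L : MvPolynomial (Fin s) ℝ,
      (∀ t : ℝ, (L + MvPolynomial.C t).totalDegree = 1) ∧
      ∀ α : Fin s → ℝ, MvPolynomial.eval (c + ∑ i, α i • v i) L = α k := by
  let b : Module.Basis (Fin s) ℝ (Fin s → ℝ) :=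
    Module.Basis.mk hv (hv.span_eq_top_of_card_eq_finrank' (by simp)).ge
  have hb : ∀ i, b i = v i := fun i => Module.Basis.mk_apply _ _ i
  let L : MvPolynomial (Fin s) ℝ :=
    ∑ j, MvPolynomial.C (b.coord k (Pi.single j 1)) * MvPolynomial.X j -
      MvPolynomial.C (b.coord k c)
  have heval : ∀ y, MvPolynomial.eval y L = b.coord k y - b.coord k c := by
    intro y
    simp only [L, map_sub, map_sum, map_mul, MvPolynomial.eval_C, MvPolynomial.eval_X]
    congr 1
    conv_rhs => rw [pi_eq_sum_univ' y, map_sum]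
    refine Finset.sum_congr rfl fun j _ => ?_
    rw [map_smul, smul_eq_mul, mul_comm]
  have hcoord : ∀ α : Fin s → ℝ, MvPolynomial.eval (c + ∑ i, α i • v i) L = α k := by
    intro α
    rw [heval, map_add, add_sub_cancel_left, map_sum]
    simp only [← hb, map_smul, Module.Basis.coord_apply, Module.Basis.repr_self, smul_eq_mul]
    rw [Finset.sum_eq_single k (fun i _ hi => by simp [hi]) (by simp)]
    simp
  refine ⟨L, fun t => le_antisymm ?_ ?_, hcoord⟩
  · refine (MvPolynomial.totalDegree_add _ _).trans (max_le ?_ (by simp))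
    refine (MvPolynomial.totalDegree_sub _ _).trans (max_le ?_ (by simp))
    refine MvPolynomial.totalDegree_finsetSum_le fun j _ => ?_
    refine (MvPolynomial.totalDegree_mul _ _).trans ?_
    simp
  -- A constant would take equal values at `c` and `c + v k`, where the coordinate is `0` and `1`.
  · by_contra! hlt
    obtain ⟨r, hr⟩ : ∃ r, L + MvPolynomial.C t = MvPolynomial.C r :=
      ⟨_, MvPolynomial.totalDegree_eq_zero_iff_eq_C.1 (Nat.lt_one_iff.1 hlt)⟩
    have h0 := congrArg (MvPolynomial.eval (c + ∑ i, (0 : Fin s → ℝ) i • v i)) hr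
    have h1 := congrArg (MvPolynomial.eval (c + ∑ i, (Pi.single k 1 : Fin s → ℝ) i • v i)) hr
    rw [map_add, hcoord, MvPolynomial.eval_C, MvPolynomial.eval_C] at h0 h1
    simp at h0 h1
    linarith

theorem totalDegree_prod_of_forall_ne_zero {ι σ : Type*} (t : Finset ι)
    (f : ι → MvPolynomial σ ℝ) (hf : ∀ i ∈ t, f i ≠ 0) :
    (∏ i ∈ t, f i).totalDegree = ∑ i ∈ t, (f i).totalDegree := by
  classical
  induction t using Finset.induction_on with
  | empty => simp
  | insert a t ha ih =>
    have h1 : ∀ i ∈ t, f i ≠ 0 := fun i hi => hf i (Finset.mem_insert_of_mem hi)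
    rw [Finset.prod_insert ha, Finset.sum_insert ha,
      MvPolynomial.totalDegree_mul_of_isDomain (hf a (Finset.mem_insert_self _ _))
        (Finset.prod_ne_zero_iff.2 h1), ih h1]

theorem exists_multichoose_polynomial (v : Fin s → Fin s → ℝ) (hv : LinearIndependent ℝ v)
    (c : Fin s → ℝ) (d : Fin s → ℕ) : ∃ p : MvPolynomial (Fin s) ℝ,
      p ≠ 0 ∧ p.totalDegree = ∑ k, d k ∧
      ∀ α : Fin s → ℕ, MvPolynomial.eval (c + ∑ i, (α i : ℝ) • v i) p =
        ∏ k, ((d k + 1).multichoose (α k) : ℝ) := by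
  choose L hdeg heval using exists_coordinate_polynomial v hv c
  let f : Fin s → ℕ → MvPolynomial (Fin s) ℝ := fun k t =>
    MvPolynomial.C ((t : ℝ) + 1)⁻¹ * (L k + MvPolynomial.C ((t : ℝ) + 1))
  have hL : ∀ k (t : ℕ), L k + MvPolynomial.C ((t : ℝ) + 1) ≠ 0 := by
    intro k t h0
    have := hdeg k ((t : ℝ) + 1)
    rw [h0, MvPolynomial.totalDegree_zero] at this
    exact zero_ne_one this
  have hC : ∀ t : ℕ, (MvPolynomial.C ((t : ℝ) + 1)⁻¹ : MvPolynomial (Fin s) ℝ) ≠ 0 := by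
    intro t
    have : ((t : ℝ) + 1)⁻¹ ≠ 0 := by positivity
    simpa using this
  have hf0 : ∀ k t, f k t ≠ 0 := fun k t => mul_ne_zero (hC t) (hL k t)
  have hf1 : ∀ k t, (f k t).totalDegree = 1 := by
    intro k t
    rw [MvPolynomial.totalDegree_mul_of_isDomain (hC t) (hL k t), hdeg, MvPolynomial.totalDegree_C]
  have hp0 : ∀ k, ∏ t ∈ Finset.range (d k), f k t ≠ 0 := fun k =>
    Finset.prod_ne_zero_iff.2 fun t _ => hf0 k t
  refine ⟨∏ k, ∏ t ∈ Finset.range (d k), f k t, Finset.prod_ne_zero_iff.2 fun k _ => hp0 k,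
    ?_, ?_⟩
  · rw [totalDegree_prod_of_forall_ne_zero _ _ fun k _ => hp0 k]
    refine Finset.sum_congr rfl fun k _ => ?_
    rw [totalDegree_prod_of_forall_ne_zero _ _ fun t _ => hf0 k t]
    simp [hf1]
  · intro α
    rw [map_prod]
    refine Finset.prod_congr rfl fun k _ => ?_
    rw [map_prod, multichoose_succ_eq_prod]
    refine Finset.prod_congr rfl fun t _ => ?_
    simp only [f, map_mul, map_add, MvPolynomial.eval_C]
    rw [heval k fun i => (α i : ℝ)]

end Polynomial

/-! ### Push-forwards over a basis. -/

section ElementaryFunctions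

variable {s N : ℕ}

theorem toReal_add (v w : Fin s → ℤ) : toReal (v + w) = toReal v + toReal w := by
  funext k
  simp [toReal]

theorem sum_nsmul_toReal {ι : Type*} (t : Finset ι) (c : ι → ℕ) (v : ι → Fin s → ℤ) :
    toReal (∑ i ∈ t, c i • v i) = ∑ i ∈ t, (c i : ℝ) • toReal (v i) := by
  funext k
  simp [toReal, Finset.sum_apply]

/-- The indicator of a lattice cone with basis among the multiples of `X` and apex in the monoid
of `X`, times a polynomial of degree `N - s`. -/
def IsElementary (X : Fin N → Fin s → ℤ) (A : Fin s → Fin s → ℤ) (c : Fin s → ℤ)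
    (p : MvPolynomial (Fin s) ℝ) : Prop :=
  LinearIndependent ℝ (fun i => toReal (A i)) ∧ (∀ i, A i ∈ multiples X) ∧
    c ∈ latticeCone X 0 ∧ p ≠ 0 ∧ p.totalDegree + s = N

/-- Independence over `ℤ` bounds the support by `s` and spanning over `ℝ` gives the reverse bound; a
spanning family of exactly `s` vectors is independent over `ℝ`. -/
theorem exists_equiv_support_of_supportIsBasis (X : Fin N → Fin s → ℤ) (h : Fin N → ℕ)
    (hB : SupportIsBasis X h) : ∃ ε : Fin s → Fin N, Function.Injective ε ∧
      (∀ i, h i ≠ 0 ↔ i ∈ Set.range ε) ∧ LinearIndependent ℝ fun k => toReal (X (ε k)) := by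
  classical
  obtain ⟨hind, hspan⟩ := hB
  have hrange : Set.range (fun i : {i // h i ≠ 0} => toReal (X i)) =
      (fun i => toReal (X i)) '' {i | h i ≠ 0} := by
    ext y
    simp
  have hle : Fintype.card {i // h i ≠ 0} ≤ s := by
    have := LinearIndependent.fintype_card_le_finrank (R := ℤ)
      (b := fun i : {i // h i ≠ 0} => X i) hind
    simpa using this
  have hge : s ≤ Fintype.card {i // h i ≠ 0} := by
    have := finrank_range_le_card (R := ℝ) (fun i : {i // h i ≠ 0} => toReal (X i))
    rw [Set.finrank, hrange, hspan] at this
    simpa using this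
  have hcard : Fintype.card (Fin s) = Fintype.card {i // h i ≠ 0} := by
    rw [Fintype.card_fin]
    exact le_antisymm hge hle
  let e : Fin s ≃ {i // h i ≠ 0} := Fintype.equivOfCardEq hcard
  have hli : LinearIndependent ℝ fun i : {i // h i ≠ 0} => toReal (X i) :=
    linearIndependent_of_top_le_span_of_card_eq_finrank (by rw [hrange, hspan])
      (by rw [← hcard]; simp)
  refine ⟨fun k => (e k : Fin N), Subtype.val_injective.comp e.injective, fun i => ?_,
    hli.comp e e.injective⟩
  constructor
  · intro hi
    exact ⟨e.symm ⟨i, hi⟩, by simp⟩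
  · rintro ⟨k, rfl⟩
    exact (e k).2

/-- By independence each fibre meets the support of the series in at most one monomial, so no
summation remains and the coefficient itself is the value. The apex is the weight of `γ`, hence lies
in the monoid of `X`. -/
theorem pushForward_monomial_smul_geomSeries (X : Fin N → Fin s → ℤ)
    (hw : ∀ x, ((Finsupp.weight X : (Fin N →₀ ℕ) →+ Fin s → ℤ) ⁻¹' {x}).Finite)
    (n h : Fin N → ℕ) (hn : ∀ i, 0 < n i) (hN : ∑ i, h i = N) (hB : SupportIsBasis X h)
    (γ : Fin N →₀ ℕ) : ∃ A c p, IsElementary X A c p ∧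
      pushForward (Finsupp.weight X) hw
        ((MvPolynomial.monomial γ 1 : MvPolynomial (Fin N) ℝ) • geomSeries n h) =
        (latticeCone A c).indicator fun y => MvPolynomial.eval (toReal y) p := by
  classical
  obtain ⟨ε, hε, hsupp, hli⟩ := exists_equiv_support_of_supportIsBasis X h hB
  have hh : ∀ k, h (ε k) ≠ 0 := fun k => (hsupp _).2 ⟨k, rfl⟩
  have hh' : ∀ i, i ∉ Set.range ε → h i = 0 := fun i hi => by
    by_contra hne
    exact hi ((hsupp i).1 hne)
  let A : Fin s → Fin s → ℤ := fun k => n (ε k) • X (ε k)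
  let c : Fin s → ℤ := Finsupp.weight X γ
  have hA : LinearIndependent ℝ fun k => toReal (A k) := by
    have hu := hli.units_smul fun k => Units.mk0 (n (ε k) : ℝ) (by
      exact_mod_cast (hn (ε k)).ne')
    convert hu using 1
    funext k j
    simp [A, toReal, Units.smul_def]
  obtain ⟨p, hp0, hpdeg, hpeval⟩ := exists_multichoose_polynomial (fun k => toReal (A k)) hA
    (toReal c) fun k => h (ε k) - 1
  have hweight : ∀ β : Fin N →₀ ℕ, Finsupp.weight X β = ∑ i, β i • X i := fun β => by
    rw [Finsupp.weight_apply, Finsupp.sum_fintype _ _ (by simp)]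
  have hdeg : p.totalDegree + s = N := by
    have h1 : ∑ k, h (ε k) = ∑ i, h i :=
      Fintype.sum_of_injective ε hε _ _ (fun i hi => hh' i hi) fun _ => rfl
    have h2 : ∑ k, h (ε k) = ∑ k, (h (ε k) - 1) + s := by
      have h3 : ∑ k, h (ε k) = ∑ k, (h (ε k) - 1 + 1) := Finset.sum_congr rfl fun k _ =>
        (Nat.sub_add_cancel (Nat.one_le_iff_ne_zero.2 (hh k))).symm
      rw [h3, Finset.sum_add_distrib]
      simp
    rw [hpdeg, ← h2, h1, hN]
  refine ⟨A, c, p, ⟨hA, fun k => ⟨ε k, n (ε k), rfl⟩, ⟨γ, by simp [c, hweight]⟩, hp0, hdeg⟩, ?_⟩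
  -- the exponents of the monomials that occur in `geomSeries n h`
  let B : (Fin s → ℕ) → (Fin N →₀ ℕ) := fun α =>
    Finsupp.equivFunOnFinite.symm (Function.extend ε (fun k => n (ε k) * α k) 0)
  have hBε : ∀ α k, B α (ε k) = n (ε k) * α k := fun α k =>
    hε.extend_apply (fun k => n (ε k) * α k) (0 : Fin N → ℕ) k
  have hB0 : ∀ α i, i ∉ Set.range ε → B α i = 0 := fun α i hi =>
    Function.extend_apply' (fun k => n (ε k) * α k) (0 : Fin N → ℕ) i (by simpa using hi)
  have hBw : ∀ α, Finsupp.weight X (B α) = ∑ k, α k • A k := by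
    intro α
    rw [hweight]
    refine (Fintype.sum_of_injective ε hε _ _ (fun i hi => ?_) fun k => ?_).symm
    · simp [hB0 α i hi]
    · rw [hBε, mul_comm, mul_smul]
  have hBcoeff : ∀ α, MvPowerSeries.coeff (B α) (geomSeries n h) =
      ∏ k, ((h (ε k) - 1 + 1).multichoose (α k) : ℝ) := by
    intro α
    rw [coeff_geomSeries]
    refine (Fintype.prod_of_injective ε hε _ _ (fun i hi => ?_) fun k => ?_).symm
    · simp [hB0 α i hi]
    · rw [hBε, Nat.sub_add_cancel (Nat.one_le_iff_ne_zero.2 (hh k))]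
      simp [hn (ε k)]
  have hBsurj : ∀ β, MvPowerSeries.coeff β (geomSeries n h) ≠ 0 → ∃ α, β = B α := by
    intro β hβ
    rw [coeff_geomSeries, Finset.prod_ne_zero_iff] at hβ
    have hd : ∀ i, n i ∣ β i := by
      intro i
      by_contra hnd
      exact hβ i (Finset.mem_univ i) (by simp [hnd])
    refine ⟨fun k => β (ε k) / n (ε k), Finsupp.ext fun i => ?_⟩
    by_cases hi : i ∈ Set.range ε
    · obtain ⟨k, rfl⟩ := hi
      rw [hBε, Nat.mul_div_cancel' (hd _)]
    · rw [hB0 _ i hi]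
      have := hβ i (Finset.mem_univ i)
      -- Off the basis `h i = 0`, and `multichoose 0 (q + 1) = 0` forces the exponent to vanish.
      rw [if_pos (hd i), hh' i hi] at this
      obtain ⟨q, hq⟩ := hd i
      rcases q with _ | q
      · simpa using hq
      · simp [hq, hn i] at this
  have hAinj : ∀ α α' : Fin s → ℕ, ∑ k, α k • A k = ∑ k, α' k • A k → α = α' := by
    intro α α' heq
    have h1 := congrArg toReal heq
    rw [sum_nsmul_toReal, sum_nsmul_toReal] at h1
    have h2 := Fintype.linearIndependent_iffₛ.1 hA (fun k => (α k : ℝ)) (fun k => (α' k : ℝ)) h1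
    funext k
    exact_mod_cast h2 k
  funext x
  rw [pushForward_monomial_smul, one_mul, pushForward_apply]
  by_cases hx : x ∈ latticeCone A c
  · rw [Set.indicator_of_mem hx]
    obtain ⟨α, rfl⟩ := hx
    rw [toReal_add, sum_nsmul_toReal, hpeval, ← hBcoeff]
    refine Finset.sum_eq_single (B α) (fun β hβ hne => ?_) fun hmem => ?_
    · by_contra h0
      obtain ⟨α', rfl⟩ := hBsurj β h0
      have h1 : Finsupp.weight X (B α') = c + ∑ k, α k • A k - c :=
        (hw _).mem_toFinset.1 hβ
      rw [hBw, add_sub_cancel_left] at h1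
      exact hne (by rw [hAinj _ _ h1])
    · refine absurd ?_ hmem
      simp [hBw, c]
  · rw [Set.indicator_of_notMem hx]
    refine Finset.sum_eq_zero fun β hβ => ?_
    by_contra h0
    obtain ⟨α, rfl⟩ := hBsurj β h0
    refine hx ⟨α, ?_⟩
    have h1 : Finsupp.weight X (B α) = x - c := (hw _).mem_toFinset.1 hβ
    rw [← hBw, h1, add_sub_cancel]

end ElementaryFunctions

/-! ### Lattice cones as real cones with congruences. -/

section Periodicity

variable {s : ℕ}

theorem sum_zsmul_injective (A : Fin s → Fin s → ℤ)
    (hA : LinearIndependent ℝ fun i => toReal (A i)) (α : Fin s → ℝ) (z : Fin s → ℤ)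
    (h : ∑ i, α i • toReal (A i) = toReal (∑ i, z i • A i)) (i : Fin s) : α i = z i := by
  rw [sum_smul_toReal] at h
  exact Fintype.linearIndependent_iffₛ.1 hA _ (fun k => (z k : ℝ)) h i

/-- Coordinates in a basis are unique, so the nonnegative real ones and the integral ones coincide.
-/
theorem mem_latticeCone_iff (A : Fin s → Fin s → ℤ)
    (hA : LinearIndependent ℝ fun i => toReal (A i)) (c x : Fin s → ℤ) :
    x ∈ latticeCone A c ↔
      toReal x ∈ realCone A c ∧ ∃ z : Fin s → ℤ, x - c = ∑ i, z i • A i := by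
  constructor
  · rintro ⟨α, rfl⟩
    refine ⟨⟨fun i => α i, fun i => Nat.cast_nonneg _, ?_⟩, fun i => α i, ?_⟩
    · rw [toReal_add, sum_nsmul_toReal]
    · rw [add_sub_cancel_left]
      exact Finset.sum_congr rfl fun i _ => (natCast_zsmul _ _).symm
  · rintro ⟨⟨α, hα, hx⟩, z, hz⟩
    have hx' : x = c + ∑ i, z i • A i := by rw [← hz, add_sub_cancel]
    have heq : ∑ i, α i • toReal (A i) = toReal (∑ i, z i • A i) := by
      rw [hx', toReal_add] at hx
      exact (add_left_cancel hx).symm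
    refine ⟨fun i => (z i).toNat, ?_⟩
    rw [hx']
    congr 1
    refine Finset.sum_congr rfl fun i _ => ?_
    have hzi : 0 ≤ z i := by
      have := hα i
      rw [sum_zsmul_injective A hA α z heq i] at this
      exact_mod_cast this
    rw [← natCast_zsmul, Int.toNat_of_nonneg hzi]

theorem det_ne_zero_of_linearIndependent_toReal (A : Fin s → Fin s → ℤ)
    (hA : LinearIndependent ℝ fun i => toReal (A i)) : (Matrix.of A).det ≠ 0 := by
  intro h0
  obtain ⟨z, hz, hz0⟩ := Matrix.exists_vecMul_eq_zero_iff.2 h0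
  have h1 : ∑ i, z i • A i = 0 := by
    funext k
    have := congrFun hz0 k
    simpa [Matrix.vecMul, dotProduct, Finset.sum_apply] using this
  have h2 : ∑ i, (0 : Fin s → ℝ) i • toReal (A i) = toReal (∑ i, z i • A i) := by
    rw [h1]
    funext k
    simp [toReal]
  refine hz (funext fun i => ?_)
  have h3 : (0 : ℝ) = z i := sum_zsmul_injective A hA 0 z h2 i
  exact_mod_cast h3.symm

/-- Cramer's rule through the adjugate: the lattice of `A` contains `det A • ℤ^s`, so membership in
it depends only on residues. -/
theorem exists_det_smul_eq_sum (A : Fin s → Fin s → ℤ) (v : Fin s → ℤ) :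
    ∃ z : Fin s → ℤ, (Matrix.of A).det • v = ∑ i, z i • A i := by
  refine ⟨Matrix.vecMul v (Matrix.of A).adjugate, ?_⟩
  have h1 : Matrix.vecMul (Matrix.vecMul v (Matrix.of A).adjugate) (Matrix.of A) =
      (Matrix.of A).det • v := by
    rw [Matrix.vecMul_vecMul, Matrix.adjugate_mul, Matrix.vecMul_smul, Matrix.vecMul_one]
  rw [← h1]
  funext k
  simp [Matrix.vecMul, dotProduct, Finset.sum_apply]

theorem isPeriodicPiecewisePolynomial_sum_indicator {m : ℕ} (A : Fin m → Fin s → Fin s → ℤ)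
    (c : Fin m → Fin s → ℤ) (p : Fin m → MvPolynomial (Fin s) ℝ) (D : ℕ)
    (hA : ∀ j, LinearIndependent ℝ fun i => toReal (A j i)) (hp : ∀ j, (p j).totalDegree ≤ D) :
    IsPeriodicPiecewisePolynomial (fun j => realCone (A j) (c j)) D fun x =>
      ∑ j, (latticeCone (A j) (c j)).indicator
        (fun y => MvPolynomial.eval (toReal y) (p j)) x := by
  classical
  let d : ℕ := ∏ j, (Matrix.of (A j)).det.natAbs
  have hd : 0 < d := Finset.prod_pos fun j _ =>
    Int.natAbs_pos.2 (det_ne_zero_of_linearIndependent_toReal (A j) (hA j))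
  have hlat : ∀ j (v : Fin s → ℤ), ∃ z : Fin s → ℤ, (d : ℤ) • v = ∑ i, z i • A j i := by
    intro j v
    obtain ⟨q, hq⟩ : (Matrix.of (A j)).det ∣ (d : ℤ) :=
      Int.natAbs_dvd.1 (Int.natCast_dvd_natCast.2
        (Finset.dvd_prod_of_mem (fun j => (Matrix.of (A j)).det.natAbs) (Finset.mem_univ j)))
    obtain ⟨z, hz⟩ := exists_det_smul_eq_sum (A j) (q • v)
    exact ⟨z, by rw [← hz, hq, mul_smul]⟩
  -- The polynomial for `(S, r)` sums those `p j` with `j ∈ S` for which an integral lift of `r`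
  -- lies in the coset of `c j`; the choice of lift is immaterial because `d • ℤ^s` lies in every
  -- lattice.
  refine ⟨d, hd, fun S => ⟨fun r => ∑ j, if j ∈ S ∧ ∃ z : Fin s → ℤ,
    (fun k => ((r k).cast : ℤ)) - c j = ∑ i, z i • A j i then p j else 0, fun r => ?_, ?_⟩⟩
  · refine MvPolynomial.totalDegree_finsetSum_le fun j _ => ?_
    split_ifs
    · exact hp j
    · simp
  · intro x hx
    change ∑ j, (latticeCone (A j) (c j)).indicator
        (fun y => MvPolynomial.eval (toReal y) (p j)) x = _
    rw [map_sum]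
    refine Finset.sum_congr rfl fun j _ => ?_
    have hS : toReal x ∈ realCone (A j) (c j) ↔ j ∈ S := by
      rw [← hx]
      rfl
    obtain ⟨v, hv⟩ : ∃ v : Fin s → ℤ,
        x - (fun k => (((x k : ℤ) : ZMod d).cast : ℤ)) = (d : ℤ) • v := by
      have : ∀ k, (d : ℤ) ∣ x k - (((x k : ℤ) : ZMod d).cast : ℤ) := by
        intro k
        rw [← ZMod.intCast_eq_intCast_iff_dvd_sub, ZMod.intCast_zmod_cast]
      choose v hv using this
      exact ⟨v, funext hv⟩
    obtain ⟨z₀, hz₀⟩ := hlat j v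
    have hmod : (∃ z : Fin s → ℤ, x - c j = ∑ i, z i • A j i) ↔ ∃ z : Fin s → ℤ,
        (fun k => (((x k : ℤ) : ZMod d).cast : ℤ)) - c j = ∑ i, z i • A j i := by
      rw [hz₀] at hv
      constructor
      · rintro ⟨z, hz⟩
        refine ⟨z - z₀, ?_⟩
        simp only [Pi.sub_apply, sub_smul, Finset.sum_sub_distrib, ← hz, ← hv]
        abel
      · rintro ⟨z, hz⟩
        refine ⟨z + z₀, ?_⟩
        simp only [Pi.add_apply, add_smul, Finset.sum_add_distrib, ← hz, ← hv]
        abel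
    have hmem : x ∈ latticeCone (A j) (c j) ↔ j ∈ S ∧ ∃ z : Fin s → ℤ,
        (fun k => (((x k : ℤ) : ZMod d).cast : ℤ)) - c j = ∑ i, z i • A j i := by
      rw [mem_latticeCone_iff _ (hA j), hS, hmod]
    by_cases hxj : x ∈ latticeCone (A j) (c j)
    · rw [Set.indicator_of_mem hxj, if_pos (hmem.1 hxj)]
    · rw [Set.indicator_of_notMem hxj, if_neg fun h => hxj (hmem.2 h), map_zero]

end Periodicity

/-! ### Finiteness and assembly. -/

section Main

variable {s N : ℕ}

/-- Two comparable representations differ by a nonnegative relation, hence coincide; by Dickson's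
lemma an antichain in `ℕ^N` is finite. -/
theorem representations_finite (X : Fin N → Fin s → ℤ)
    (hX : ∀ u : Fin N → ℝ, (∀ i, 0 ≤ u i) → ∑ i, u i • toReal (X i) = 0 → u = 0)
    (x : Fin s → ℤ) : (representations X x).Finite := by
  have hanti : IsAntichain (· ≤ ·) (representations X x) := by
    intro β hβ β' hβ' hne hle
    refine hne ?_
    have h0 := hX (fun i => (β' i : ℝ) - β i) (fun i => sub_nonneg.2 (by exact_mod_cast hle i)) (by
      simp only [sub_smul, Finset.sum_sub_distrib, ← sum_nsmul_toReal]
      rw [show ∑ i, β' i • X i = x from hβ', show ∑ i, β i • X i = x from hβ, sub_self])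
    funext i
    have := congrFun h0 i
    simp only [Pi.zero_apply, sub_eq_zero] at this
    exact_mod_cast this.symm
  exact hanti.finite_of_partiallyWellOrderedOn (Set.isPWO_of_wellQuasiOrderedLE _)

theorem latticeCone_subset {n : ℕ} (X : Fin N → Fin s → ℤ) (A : Fin n → Fin s → ℤ) (c : Fin s → ℤ)
    (hA : ∀ i, A i ∈ multiples X) (hc : c ∈ latticeCone X 0) :
    latticeCone A c ⊆ latticeCone X 0 := by
  let Λ : AddSubmonoid (Fin s → ℤ) :=
    AddMonoidHom.mrange (Finsupp.weight X : (Fin N →₀ ℕ) →+ Fin s → ℤ)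
  have hΛ : ∀ x, x ∈ latticeCone X 0 ↔ x ∈ Λ := by
    intro x
    constructor
    · rintro ⟨α, rfl⟩
      refine ⟨Finsupp.equivFunOnFinite.symm α, ?_⟩
      rw [Finsupp.weight_apply, Finsupp.sum_fintype _ _ (by simp), zero_add]
      rfl
    · rintro ⟨β, rfl⟩
      refine ⟨β, ?_⟩
      rw [Finsupp.weight_apply, Finsupp.sum_fintype _ _ (by simp), zero_add]
  rintro _ ⟨α, rfl⟩
  rw [hΛ] at hc ⊢
  refine Λ.add_mem hc (Λ.sum_mem fun i _ => Λ.nsmul_mem ?_ _)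
  obtain ⟨l, n, hl⟩ := hA i
  rw [hl]
  refine Λ.nsmul_mem ⟨Finsupp.single l 1, ?_⟩ _
  simp [Finsupp.weight_apply]

theorem weight_preimage_eq (X : Fin N → Fin s → ℤ) (x : Fin s → ℤ) :
    ((Finsupp.weight X : (Fin N →₀ ℕ) →+ Fin s → ℤ) ⁻¹' {x}) =
      Finsupp.equivFunOnFinite ⁻¹' representations X x := by
  ext β
  simp only [Set.mem_preimage, Set.mem_singleton_iff, Finsupp.weight_apply]
  rw [Finsupp.sum_fintype _ _ (by simp)]
  rfl

theorem partitionFunction_eq_pushForward (X : Fin N → Fin s → ℤ)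
    (hw : ∀ x, ((Finsupp.weight X : (Fin N →₀ ℕ) →+ Fin s → ℤ) ⁻¹' {x}).Finite)
    (x : Fin s → ℤ) : (partitionFunction X x : ℝ) =
      pushForward (Finsupp.weight X) hw (geomSeries 1 1) x := by
  rw [pushForward_apply]
  simp only [coeff_geomSeries, Pi.one_apply, isUnit_one, IsUnit.dvd, if_true, Nat.multichoose_one,
    Nat.cast_one, Finset.prod_const_one, Finset.sum_const, nsmul_eq_mul, mul_one]
  rw [← Set.ncard_eq_toFinset_card _ (hw x), weight_preimage_eq, partitionFunction,
    Set.ncard_preimage_of_injective_subset_range Finsupp.equivFunOnFinite.injective (by simp)]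

/-- Splitting the polynomial numerators into monomials turns a polynomial combination upstairs into
a real combination of elementary functions. -/
theorem pushForward_mem_span_of_mem_basicSpan (X : Fin N → Fin s → ℤ)
    (hw : ∀ x, ((Finsupp.weight X : (Fin N →₀ ℕ) →+ Fin s → ℤ) ⁻¹' {x}).Finite)
    (F : MvPowerSeries (Fin N) ℝ) (hF : F ∈ basicSpan X hw N) :
    pushForward (Finsupp.weight X) hw F ∈ Submodule.span ℝ
      {f | ∃ A c p, IsElementary X A c p ∧
        f = (latticeCone A c).indicator fun y => MvPolynomial.eval (toReal y) p} := by
  obtain ⟨F₁, hF₁, F₂, hF₂, rfl⟩ := Submodule.mem_sup.1 hF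
  rw [map_add, (mem_pushForwardKer _ hw).1 hF₂, add_zero]
  obtain ⟨k, q, g, rfl⟩ := Submodule.mem_span_set'.1 hF₁
  rw [map_sum]
  refine Submodule.sum_mem _ fun l _ => ?_
  obtain ⟨n, h, hn, hN, hB, hg⟩ := (g l).2
  rw [hg]
  induction q l using MvPolynomial.induction_on' with
  | monomial γ r =>
    obtain ⟨A, c, p, hE, hf⟩ := pushForward_monomial_smul_geomSeries X hw n h hn hN hB γ
    have hr : pushForward (Finsupp.weight X) hw
          ((MvPolynomial.monomial γ r : MvPolynomial (Fin N) ℝ) • geomSeries n h) =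
        r • pushForward (Finsupp.weight X) hw
          ((MvPolynomial.monomial γ 1 : MvPolynomial (Fin N) ℝ) • geomSeries n h) := by
      funext x
      simp [pushForward_monomial_smul]
    rw [hr]
    exact Submodule.smul_mem _ r (Submodule.subset_span ⟨A, c, p, hE, hf⟩)
  | add p q hp hq =>
    rw [add_smul, map_add]
    exact Submodule.add_mem _ hp hq

theorem exists_partitionFunction_eq_sum (X : Fin N → Fin s → ℤ)
    (hspan : Submodule.span ℝ (Set.range fun i => toReal (X i)) = ⊤)
    (hX : ∀ u : Fin N → ℝ, (∀ i, 0 ≤ u i) → ∑ i, u i • toReal (X i) = 0 → u = 0) :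
    ∃ (m : ℕ) (A : Fin m → Fin s → Fin s → ℤ) (c : Fin m → Fin s → ℤ)
      (p : Fin m → MvPolynomial (Fin s) ℝ), (∀ j, IsElementary X (A j) (c j) (p j)) ∧
      ∀ x, (partitionFunction X x : ℝ) = ∑ j, (latticeCone (A j) (c j)).indicator
          (fun y => MvPolynomial.eval (toReal y) (p j)) x := by
  classical
  have hw : ∀ x, ((Finsupp.weight X : (Fin N →₀ ℕ) →+ Fin s → ℤ) ⁻¹' {x}).Finite := fun x => by
    rw [weight_preimage_eq]
    exact (representations_finite X hX x).preimage Finsupp.equivFunOnFinite.injective.injOn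
  have hmem := pushForward_mem_span_of_mem_basicSpan X hw (geomSeries 1 1)
    (geomSeries_mem_basicSpan X hw N 1 1 (by simp) (by simp) (by simpa using hspan))
  obtain ⟨l, r, g, hg⟩ := Submodule.mem_span_set'.1 hmem
  choose A c p hE hf using fun i => (g i).2
  -- Terms with coefficient zero are dropped, so that absorbing the scalars keeps each polynomial
  -- nonzero and of the same degree.
  let e := Fintype.equivFin {i // r i ≠ 0}
  refine ⟨_, fun j => A (e.symm j), fun j => c (e.symm j),
    fun j => MvPolynomial.C (r (e.symm j)) * p (e.symm j), fun j => ?_, fun x => ?_⟩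
  · obtain ⟨h1, h2, h3, h4, h5⟩ := hE (e.symm j)
    have hC : (MvPolynomial.C (r (e.symm j)) : MvPolynomial (Fin s) ℝ) ≠ 0 := by
      simpa using (e.symm j).2
    refine ⟨h1, h2, h3, mul_ne_zero hC h4, ?_⟩
    rw [MvPolynomial.totalDegree_mul_of_isDomain hC h4, MvPolynomial.totalDegree_C, zero_add, h5]
  · rw [partitionFunction_eq_pushForward X hw, ← hg, Finset.sum_apply]
    have hterm : ∀ i, (r i • (g i : (Fin s → ℤ) → ℝ)) x = (latticeCone (A i) (c i)).indicator
        (fun y => MvPolynomial.eval (toReal y) (MvPolynomial.C (r i) * p i)) x := by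
      intro i
      rw [hf i, Pi.smul_apply]
      by_cases hx : x ∈ latticeCone (A i) (c i) <;> simp [hx]
    refine (Fintype.sum_of_injective (fun j => (e.symm j : Fin l))
      (Subtype.val_injective.comp e.symm.injective) _ _ (fun i hi => ?_) fun j => ?_).symm
    · have : r i = 0 := by
        by_contra hne
        exact hi ⟨e ⟨i, hne⟩, by simp⟩
      simp [this]
    · exact (hterm _).symm

end Main

end DiscreteTruncatedPower

open DiscreteTruncatedPower in
theorem theorem3p4 {s N : ℕ} (X : Fin N → Fin s → ℤ)
    (hspan : Submodule.span ℝ (Set.range fun i => toReal (X i)) = ⊤)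
    (hX : ∀ u : Fin N → ℝ, (∀ i, 0 ≤ u i) → ∑ i, u i • toReal (X i) = 0 → u = 0) :
    (∀ x, (representations X x).Finite) ∧
    ∃ (m : ℕ) (A : Fin m → Fin s → Fin s → ℤ) (c : Fin m → Fin s → ℤ)
      (p : Fin m → MvPolynomial (Fin s) ℝ),
      (∀ j, LinearIndependent ℝ fun i => toReal (A j i)) ∧
      (∀ j i, A j i ∈ multiples X) ∧
      (∀ j, c j ∈ latticeCone X 0) ∧
      (∀ j, latticeCone (A j) (c j) ⊆ latticeCone X 0) ∧
      (∀ j, p j ≠ 0 ∧ (p j).totalDegree + s = N) ∧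
      (∀ x, (partitionFunction X x : ℝ) =
        ∑ j, (latticeCone (A j) (c j)).indicator
          (fun y => MvPolynomial.eval (toReal y) (p j)) x) ∧
      IsPeriodicPiecewisePolynomial (fun j => realCone (A j) (c j)) (N - s)
        (fun x => (partitionFunction X x : ℝ)) := by
  refine ⟨representations_finite X hX, ?_⟩
  obtain ⟨m, A, c, p, hE, hsum⟩ := exists_partitionFunction_eq_sum X hspan hX
  refine ⟨m, A, c, p, fun j => (hE j).1, fun j => (hE j).2.1, fun j => (hE j).2.2.1,
    fun j => latticeCone_subset X (A j) (c j) (hE j).2.1 (hE j).2.2.1,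
    fun j => (hE j).2.2.2, hsum, ?_⟩
  have hper := isPeriodicPiecewisePolynomial_sum_indicator A c p (N - s) (fun j => (hE j).1)
    fun j => by
      have := (hE j).2.2.2.2
      omega
  rwa [← funext hsum] at hper
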